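/- Let $0\le n\le m$ be integers and let $f\in\mathbb{R}[x_1,\dots,x_m]$ be real stable, i.e. $f(z)\neq 0$ for every $z\in\mathbb{C}^m$ with $\operatorname{Im} z_i>0$ for all $i$. Suppose that $f$ is irreducible in $\mathbb{R}[x_1,\dots,x_m]$ and that $$f=\det\Big(\operatorname{diag}(x_1,\dots,x_n)+\sum_{j=n+1}^{m}A_jx_j+A_0\Big)$$ for some complex $n\times n$ matrices $A_0,A_{n+1},\dots,A_m$. Then there is an invertible real diagonal $n\times n$ matrix $D$ such that $D^{-1}A_jD$ is Hermitian for every $j\in\{0,n+1,\dots,m\}$. -/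

import Mathlib

/-- A real polynomial in the variables `σ` is (real) stable if it does not vanish at any complex
point all of whose coordinates have positive imaginary part. -/
def IsRealStable {σ : Type*} (f : MvPolynomial σ ℝ) : Prop :=
  ∀ z : σ → ℂ, (∀ i, 0 < (z i).im) → MvPolynomial.aeval z f ≠ 0

/-- The matrix `diag(x₁, …, xₙ) + ∑ⱼ Aⱼ yⱼ + A₀` of complex affine linear polynomials. The
variables are `xᵢ = X (Sum.inl i)` for `i : Fin n` and `yⱼ = X (Sum.inr j)` for `j : Fin k`. -/
noncomputable def detRepMatrix {n k : ℕ} (A₀ : Matrix (Fin n) (Fin n) ℂ)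
    (A : Fin k → Matrix (Fin n) (Fin n) ℂ) :
    Matrix (Fin n) (Fin n) (MvPolynomial (Fin n ⊕ Fin k) ℂ) :=
  Matrix.diagonal (fun i => MvPolynomial.X (Sum.inl i))
    + ∑ j, (MvPolynomial.X (Sum.inr j) : MvPolynomial (Fin n ⊕ Fin k) ℂ) •
        (A j).map MvPolynomial.C
    + A₀.map MvPolynomial.C

/-- The complex matrix `D⁻¹ * B * D`, for a real matrix `D` (meant to be invertible). -/
noncomputable def realConj {n : ℕ} (D : Matrix (Fin n) (Fin n) ℝ)
    (B : Matrix (Fin n) (Fin n) ℂ) : Matrix (Fin n) (Fin n) ℂ :=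
  (D.map Complex.ofReal)⁻¹ * B * D.map Complex.ofReal

/-! At a real point `x` with `f x ≠ 0`, let `M` be the value of the pencil and `N = M⁻¹`. The
Rayleigh difference `f(x+eᵢ) f(x+eⱼ) - f(x) f(x+eᵢ+eⱼ)` equals `f(x)² Nᵢⱼ Nⱼᵢ`. Stability makes it
nonnegative (`IsRealStable.inv_pencil_mul_nonneg`), and irreducibility makes it a nonzero polynomial
(`rayleighDiff_ne_zero`), so generically `Nᵢⱼ Nⱼᵢ > 0`.

Moving `x` along `eₖ` turns `Nᵢⱼ` and `Nⱼᵢ`, up to a common real factor, into affine functions with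
nonnegative product; `Complex.mul_conj_eq_of_affine_mul_nonneg` makes one a positive multiple of the
conjugate of the other. The resulting cocycle identity says that the ratios `Nᵢⱼ / conj Nⱼᵢ` have
the form `eᵢ / eⱼ` with `e > 0`, so a diagonal conjugation makes `N`, hence `M`, Hermitian
(`Matrix.exists_pos_div_mul_conj`).

The same affine lemma, applied to the entries of the pencil on lines through one generic point,
shows that this `e` serves every real point. -/

open ComplexOrder ComplexConjugate

/-! ### Diagonal perturbations of determinants and inverses. -/

namespace Matrix

variable {ι K : Type*} [Fintype ι] [DecidableEq ι] [Field K]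

/-- The effect on the determinant of changing two diagonal entries. -/
theorem det_add_single_add_single {M : Matrix ι ι K} (hM : M.det ≠ 0) (i j : ι) (s t : K) :
    (M + single i i s + single j j t).det =
      M.det * ((1 + s * M⁻¹ i i) * (1 + t * M⁻¹ j j) - s * t * (M⁻¹ i j * M⁻¹ j i)) := by
  -- The perturbation factors through dimension two, so `det (1 + XY) = det (1 + YX)` leaves a 2 × 2
  -- determinant. The case `i = j` is covered.
  let p : Fin 2 → ι := ![i, j]
  let U : Matrix ι (Fin 2) K := of fun a b => if a = p b then 1 else 0
  let V : Matrix (Fin 2) ι K := of fun b a => if a = p b then ![s, t] b else 0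
  have hUV : single i i s + single j j t = U * V := by
    ext a b
    simp only [U, V, p, Matrix.mul_apply, Fin.sum_univ_two, Matrix.add_apply, single_apply,
      of_apply, Matrix.cons_val_zero, Matrix.cons_val_one]
    grind
  have hVNU : ∀ b c, (V * (M⁻¹ * U)) b c = ![s, t] b * M⁻¹ (p b) (p c) := by
    intro b c
    simp [U, V, Matrix.mul_apply]
  have : M + single i i s + single j j t = M * (1 + (M⁻¹ * U) * V) := by
    rw [add_assoc, hUV, Matrix.mul_add, Matrix.mul_one, Matrix.mul_assoc,
      mul_nonsing_inv_cancel_left _ _ hM.isUnit]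
  rw [this, det_mul, det_one_add_mul_comm, det_fin_two]
  simp only [Matrix.add_apply, hVNU, Matrix.one_apply]
  simp only [p, Matrix.cons_val_zero, Matrix.cons_val_one, zero_ne_one, one_ne_zero, if_true,
    if_false]
  ring

/-- The determinant is an affine function of each diagonal entry. -/
theorem det_add_single (M : Matrix ι ι K) (i : ι) (t : K) :
    (M + single i i t).det = M.det + t * ((M + single i i 1).det - M.det) := by
  have key : ∀ s : K, (M + single i i s).det
      = M.det + s * (M.updateRow i (Pi.single i 1)).det := by
    intro s
    have : M + single i i s = M.updateRow i (M i + s • Pi.single i 1) := by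
      ext a b
      by_cases ha : a = i
      · subst ha
        simp [single_apply, Pi.single_apply, eq_comm]
      · simp [ha, Ne.symm ha]
    rw [this, det_updateRow_add, det_updateRow_smul, updateRow_eq_self]
  rw [key t, key 1]
  ring

theorem det_add_single_of_det_ne_zero {M : Matrix ι ι K} (hM : M.det ≠ 0) (i : ι) (t : K) :
    (M + single i i t).det = M.det * (1 + t * M⁻¹ i i) := by
  simpa using det_add_single_add_single hM i i t 0

/-- The inverse of a matrix with one diagonal entry changed (Sherman–Morrison). -/
theorem inv_add_single_apply {M : Matrix ι ι K} (hM : M.det ≠ 0) (k : ι) (t : K)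
    (hk : 1 + t * M⁻¹ k k ≠ 0) (a b : ι) :
    (M + single k k t)⁻¹ a b * (1 + t * M⁻¹ k k) =
      M⁻¹ a b + t * (M⁻¹ a b * M⁻¹ k k - M⁻¹ a k * M⁻¹ k b) := by
  have hinv : (M + single k k t)⁻¹
      = M⁻¹ - (t / (1 + t * M⁻¹ k k)) • of fun a b => M⁻¹ a k * M⁻¹ k b := by
    apply inv_eq_right_inv
    have h1 : M * (of fun a b => M⁻¹ a k * M⁻¹ k b) = of fun a b => if a = k then M⁻¹ k b else 0 := by
      ext a b
      have := congrFun (congrFun (mul_nonsing_inv M hM.isUnit) a) k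
      rw [Matrix.mul_apply] at this
      simp only [Matrix.mul_apply, of_apply, ← mul_assoc, ← Finset.sum_mul]
      rw [this, Matrix.one_apply]
      simp
    have h2 : single k k t * M⁻¹ = of fun a b => if a = k then t * M⁻¹ k b else 0 := by
      ext a b
      by_cases ha : a = k
      · subst ha; simp
      · simp [ha]
    have h3 : single k k t * (of fun a b => M⁻¹ a k * M⁻¹ k b)
        = of fun a b => if a = k then t * M⁻¹ k k * M⁻¹ k b else 0 := by
      ext a b
      by_cases ha : a = k
      · subst ha; simp [mul_assoc]
      · simp [ha]
    rw [Matrix.add_mul, Matrix.mul_sub, Matrix.mul_sub, mul_nonsing_inv _ hM.isUnit,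
      Matrix.mul_smul, Matrix.mul_smul, h1, h2, h3]
    ext a b
    by_cases ha : a = k
    · subst ha; simp
      field_simp
      ring
    · simp [ha]
  rw [hinv]
  simp
  field_simp
  ring

end Matrix

/-- If a product of two complex affine functions of one real variable is nonnegative on a dense
set, then the two functions are proportional up to conjugation. -/
theorem Complex.mul_conj_eq_of_affine_mul_nonneg {p₀ p₁ q₀ q₁ : ℂ} {S : Set ℝ} (hS : Dense S)
    (h : ∀ t ∈ S, 0 ≤ (p₀ + t * p₁) * (q₀ + t * q₁)) (hp : p₀ ≠ 0) (hq : q₀ ≠ 0) :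
    q₁ * conj p₀ = q₀ * conj p₁ := by
  have h' : ∀ t : ℝ, 0 ≤ (p₀ + t * p₁) * (q₀ + t * q₁) := by
    have hc : IsClosed {t : ℝ | 0 ≤ (p₀ + t * p₁) * (q₀ + t * q₁)} :=
      isClosed_le continuous_const (by fun_prop)
    intro t
    exact hc.closure_subset_iff.2 h (hS t)
  have h0 : 0 < p₀ * q₀ := by
    have := h' 0
    simp only [ofReal_zero, zero_mul, add_zero] at this
    exact lt_of_le_of_ne this (mul_ne_zero hp hq).symm
  obtain ⟨u, hu⟩ : ∃ u, p₁ = p₀ * u := ⟨p₁ / p₀, by field_simp⟩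
  obtain ⟨w, hw⟩ : ∃ w, q₁ = q₀ * w := ⟨q₁ / q₀, by field_simp⟩
  have h1 : ∀ t : ℝ, 0 ≤ (1 + t * u) * (1 + t * w) := by
    intro t
    have := h' t
    rw [hu, hw, show (p₀ + t * (p₀ * u)) * (q₀ + t * (q₀ * w))
      = (p₀ * q₀) * ((1 + t * u) * (1 + t * w)) by ring] at this
    exact le_of_mul_le_mul_left (by rwa [mul_zero]) h0
  have hwu : w = conj u := by
    obtain ⟨a, b⟩ := u
    obtain ⟨c, d⟩ := w
    have hre : ∀ t : ℝ, 0 ≤ 1 + t * (a + c) + t ^ 2 * (a * c - b * d) := by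
      intro t
      have := (Complex.le_def.1 (h1 t)).1
      simp at this
      linarith
    have him : ∀ t : ℝ, t * (b + d) + t ^ 2 * (a * d + b * c) = 0 := by
      intro t
      have := (Complex.le_def.1 (h1 t)).2
      simp at this
      linarith
    have i1 := him 1
    have i2 := him (-1)
    -- The imaginary parts settle `b ≠ 0`. If `b = 0`, both factors are real and the discriminant
    -- bound becomes `(c - a)² ≤ 0`.
    have hd : d = -b := by linarith
    have hb : b * (c - a) = 0 := by subst hd; linarith
    have hdisc := discrim_le_zero (a := a * c - b * d) (b := a + c) (c := 1)
      (fun t => by have := hre t; linarith)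
    rw [discrim] at hdisc
    subst hd
    have hac : c = a := by
      rcases mul_eq_zero.1 hb with rfl | hb
      · have : (c - a) ^ 2 ≤ 0 := by linarith
        have := pow_eq_zero_iff (two_ne_zero) |>.1 (le_antisymm this (sq_nonneg _))
        linarith
      · linarith
    subst hac
    rfl
  rw [hu, hw, hwu, map_mul]
  ring

/-! ### Symmetrizing one matrix through its inverse. -/

namespace Matrix

variable {ι : Type*} [Fintype ι] [DecidableEq ι]

/-- If products of opposite off-diagonal entries of the inverse of `M` are positive, and remain
nonnegative when any real number is added to a diagonal entry of `M`, then `M` is Hermitian up to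
conjugation by a positive diagonal matrix. -/
theorem exists_pos_div_mul_conj {M : Matrix ι ι ℂ} (hM : M.det ≠ 0)
    (hdiag : ∀ i, conj (M⁻¹ i i) = M⁻¹ i i)
    (hne : ∀ i j, i ≠ j → M⁻¹ i j ≠ 0)
    (hnonneg : ∀ i j k (t : ℝ), i ≠ j → (M + single k k (t : ℂ)).det ≠ 0 →
      0 ≤ (M + single k k (t : ℂ))⁻¹ i j * (M + single k k (t : ℂ))⁻¹ j i) :
    ∃ e : ι → ℝ, (∀ i, 0 < e i) ∧ ∀ i j, M j i = e j / e i * conj (M i j) := by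
  rcases isEmpty_or_nonempty ι with hι | ⟨⟨o⟩⟩
  · exact ⟨fun _ => 1, fun i => (IsEmpty.false i).elim, fun i => (IsEmpty.false i).elim⟩
  set N := M⁻¹ with hN
  have hpos : ∀ i j, i ≠ j → 0 < N i j * N j i := by
    intro i j hij
    have := hnonneg i j i 0 hij (by simpa using hM)
    simp only [Complex.ofReal_zero, single_zero, add_zero] at this
    exact lt_of_le_of_ne this (mul_ne_zero (hne i j hij) (hne j i hij.symm)).symm
  -- This is the affine lemma for the perturbation at `k`, after clearing the real denominator `1 +
  -- t * N k k`; the terms with the real number `N k k` cancel.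
  have hcocycle : ∀ i j k, i ≠ j → i ≠ k → j ≠ k →
      N j k * N k i * conj (N i j) = N j i * (conj (N i k) * conj (N k j)) := by
    intro i j k hij hik hjk
    let S : Set ℝ := {t | 1 + t * N k k ≠ 0}
    have hNre : ((N k k).re : ℂ) = N k k := Complex.conj_eq_iff_re.1 (hdiag k)
    have hS : Dense S := by
      by_cases h0 : N k k = 0
      · have : S = Set.univ := by ext t; simp [S, h0]
        rw [this]; exact dense_univ
      · refine (dense_compl_singleton (-1 / (N k k).re : ℝ)).mono ?_
        intro t ht h1
        apply ht
        have h2 : 1 + t * (N k k).re = 0 := by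
          rw [← hNre] at h1
          exact_mod_cast h1
        have h3 : (N k k).re ≠ 0 := fun h => h0 (by rw [← hNre, h]; rfl)
        rw [Set.mem_singleton_iff, eq_div_iff h3]
        linarith
    have hQ := Complex.mul_conj_eq_of_affine_mul_nonneg hS (p₀ := N i j)
      (p₁ := N i j * N k k - N i k * N k j) (q₀ := N j i) (q₁ := N j i * N k k - N j k * N k i)
      (by
        intro t ht
        rw [← inv_add_single_apply hM k t ht, ← inv_add_single_apply hM k t ht]
        have hdet : (M + single k k (t : ℂ)).det ≠ 0 := by
          rw [det_add_single_of_det_ne_zero hM]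
          exact mul_ne_zero hM ht
        have hsq : 0 ≤ (1 + t * N k k) ^ 2 := by
          rw [← hNre]
          exact_mod_cast sq_nonneg (1 + t * (N k k).re)
        have := mul_nonneg (hnonneg i j k t hij hdet) hsq
        convert! this using 1
        ring) (hne i j hij) (hne j i hij.symm)
    rw [map_sub, map_mul, map_mul, hdiag] at hQ
    linear_combination -hQ
  -- `N i o / conj (N o i)` as a positive real number
  let e : ι → ℝ := fun i => if i = o then 1 else (N i o * N o i).re / Complex.normSq (N o i)
  have he : ∀ i, 0 < e i := by
    intro i
    by_cases h : i = o
    · simp [e, h]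
    · simp only [e, h, if_false]
      exact div_pos (Complex.lt_def.1 (hpos i o h)).1 (Complex.normSq_pos.2 (hne o i (Ne.symm h)))
  have heo : ∀ i, N i o = e i * conj (N o i) := by
    intro i
    by_cases h : i = o
    · simp [e, h, hdiag]
    · have h1 : (((N i o * N o i).re : ℝ) : ℂ) = N i o * N o i :=
        (Complex.eq_re_of_ofReal_le (r := 0) (by simpa using (hpos i o h).le)).symm
      have h2 := hne o i (Ne.symm h)
      have h3 : conj (N o i) ≠ 0 := by simpa using h2
      simp only [e, h, if_false, Complex.ofReal_div, h1, Complex.normSq_eq_conj_mul_self]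
      field_simp
  have hec : ∀ i, (e i : ℂ) ≠ 0 := fun i => by exact_mod_cast (he i).ne'
  -- The cocycle identity with `k = o` reduces a general pair to the pairs containing `o`.
  have heN : ∀ i j, N j i * e i = e j * conj (N i j) := by
    intro i j
    by_cases hj : j = o
    · subst hj
      have h1 := heo i
      have h2 : e j = 1 := by simp [e]
      have h3 := congrArg conj h1
      simp only [map_mul, Complex.conj_conj, Complex.conj_ofReal] at h3
      rw [h2, h3]
      push_cast
      ring
    by_cases hi : i = o
    · subst hi
      have h2 : e i = 1 := by simp [e]
      rw [heo j, h2]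
      simp
    by_cases hij : i = j
    · subst hij
      rw [hdiag, mul_comm]
    have hc := hcocycle i j o hij hi hj
    have h1 := heo i
    have h3 := congrArg conj h1
    simp only [map_mul, Complex.conj_conj, Complex.conj_ofReal] at h3
    rw [heo j, h3] at hc
    have hx : conj (N o j) ≠ 0 := by simpa using hne o j (Ne.symm hj)
    have hy : N o i ≠ 0 := hne o i (Ne.symm hi)
    apply mul_left_cancel₀ (mul_ne_zero hx hy)
    linear_combination -hc
  refine ⟨e, he, ?_⟩
  let E : Matrix ι ι ℂ := diagonal fun i => (e i : ℂ)
  have hNE : N * E = E * Nᴴ := by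
    ext a b
    simp [E, heN]
  have hME : E * Mᴴ = M * E := by
    have h1 : M * N = 1 := mul_nonsing_inv M hM.isUnit
    have h2 : Nᴴ * Mᴴ = 1 := by rw [← conjTranspose_mul, h1, conjTranspose_one]
    calc E * Mᴴ = M * N * (E * Mᴴ) := by rw [h1, Matrix.one_mul]
      _ = M * (N * E) * Mᴴ := by simp only [Matrix.mul_assoc]
      _ = M * E * (Nᴴ * Mᴴ) := by rw [hNE]; simp only [Matrix.mul_assoc]
      _ = M * E := by rw [h2, Matrix.mul_one]
  intro i j
  have := congrFun (congrFun hME j) i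
  simp only [E, diagonal_mul, mul_diagonal, conjTranspose_apply, Complex.star_def] at this
  have h1 := hec i
  field_simp
  linear_combination -this

end Matrix

/-! ### Generic real points and translates. -/

/-- The points of real affine space at which a nonzero complex polynomial does not vanish are
dense. -/
theorem MvPolynomial.dense_eval_ofReal_ne_zero {σ : Type*} [Fintype σ] {P : MvPolynomial σ ℂ}
    (hP : P ≠ 0) : Dense {x : σ → ℝ | eval (fun v => (x v : ℂ)) P ≠ 0} := by
  rw [Metric.dense_iff]
  intro x r hr
  by_contra hcon
  apply hP
  refine funext_set (fun v => Complex.ofReal '' Set.Ioo (x v - r) (x v + r))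
    (fun v => (Set.Ioo_infinite (by linarith)).image Complex.ofReal_injective.injOn) ?_
  intro z hz
  choose y hy hyz using fun v => hz v (Set.mem_univ v)
  obtain rfl : (fun v => (y v : ℂ)) = z := _root_.funext hyz
  rw [map_zero]
  by_contra hne
  refine hcon ⟨y, ?_, hne⟩
  rw [Metric.mem_ball, dist_pi_lt_iff hr]
  intro v
  rw [Real.dist_eq, abs_lt]
  obtain ⟨h1, h2⟩ := hy v
  constructor <;> linarith

namespace MvPolynomial

variable {σ R : Type*} [CommRing R]

/-- The polynomial `f(x + w)`. -/
noncomputable def translate (w : σ → R) (f : MvPolynomial σ R) : MvPolynomial σ R :=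
  aeval (fun v => X v + C (w v)) f

theorem eval_translate (w x : σ → R) (f : MvPolynomial σ R) :
    eval x (translate w f) = eval (x + w) f := by
  have h : (eval x).comp (aeval (R := R) fun v => X v + C (w v)).toRingHom = eval (x + w) := by
    ext v <;> simp
  exact congrArg (fun φ => φ f) h

end MvPolynomial

/-! ### The pencil, Rayleigh differences and stability. -/

section Pencil

variable {n k : ℕ} (A₀ : Matrix (Fin n) (Fin n) ℂ) (A : Fin k → Matrix (Fin n) (Fin n) ℂ)

/-- The value of `detRepMatrix A₀ A` at a complex point. -/
noncomputable def pencil (z : Fin n ⊕ Fin k → ℂ) : Matrix (Fin n) (Fin n) ℂ :=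
  (detRepMatrix A₀ A).map (MvPolynomial.eval z)

theorem pencil_apply (z : Fin n ⊕ Fin k → ℂ) (a b : Fin n) :
    pencil A₀ A z a b = MvPolynomial.eval z (detRepMatrix A₀ A a b) := rfl

theorem pencil_eq (z : Fin n ⊕ Fin k → ℂ) :
    pencil A₀ A z =
      Matrix.diagonal (fun i => z (Sum.inl i)) + ∑ j, z (Sum.inr j) • A j + A₀ := by
  ext a b
  simp only [pencil_apply, detRepMatrix, Matrix.add_apply, Matrix.sum_apply, Matrix.smul_apply,
    Matrix.map_apply, smul_eq_mul, map_add, map_sum, map_mul, MvPolynomial.eval_X,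
    MvPolynomial.eval_C, Matrix.diagonal_apply]
  split_ifs <;> simp

theorem pencil_add_single_inl (z : Fin n ⊕ Fin k → ℂ) (i : Fin n) (s : ℂ) :
    pencil A₀ A (z + Pi.single (Sum.inl i) s) = pencil A₀ A z + Matrix.single i i s := by
  have : Matrix.diagonal (fun a => (z + Pi.single (Sum.inl i) s : Fin n ⊕ Fin k → ℂ) (Sum.inl a))
      = Matrix.diagonal (fun a => z (Sum.inl a)) + Matrix.single i i s := by
    ext a b
    by_cases hab : a = b
    · subst hab
      by_cases ha : a = i
      · subst ha; simp
      · simp [ha, Ne.symm ha]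
    · rw [Matrix.add_apply, Matrix.diagonal_apply_ne _ hab, Matrix.diagonal_apply_ne _ hab,
        Matrix.single_apply_of_ne _ _ _ _ _ (by grind), add_zero]
  rw [pencil_eq, pencil_eq, this]
  simp
  abel

theorem continuous_pencil : Continuous (pencil A₀ A) := by
  refine continuous_matrix fun a b => ?_
  exact MvPolynomial.continuous_eval _

theorem pencil_affine (z w : Fin n ⊕ Fin k → ℂ) (t : ℂ) :
    pencil A₀ A (fun v => z v + t * (w v - z v)) =
      pencil A₀ A z + t • (pencil A₀ A w - pencil A₀ A z) := by
  have h1 : Matrix.diagonal (fun i : Fin n => z (Sum.inl i) + t * (w (Sum.inl i) - z (Sum.inl i)))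
      = Matrix.diagonal (fun i => z (Sum.inl i)) + t • (Matrix.diagonal (fun i => w (Sum.inl i))
        - Matrix.diagonal (fun i => z (Sum.inl i))) := by
    ext a b
    by_cases hab : a = b
    · subst hab; simp
    · simp [hab]
  simp only [pencil_eq, h1, add_smul, mul_smul, sub_smul, Finset.sum_add_distrib,
    ← Finset.smul_sum, Finset.sum_sub_distrib]
  module

variable {A₀ A} {f : MvPolynomial (Fin n ⊕ Fin k) ℝ}

theorem aeval_eq_det_pencil
    (hdet : MvPolynomial.map Complex.ofRealHom f = (detRepMatrix A₀ A).det)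
    (z : Fin n ⊕ Fin k → ℂ) : MvPolynomial.aeval z f = (pencil A₀ A z).det := by
  have := congrArg (MvPolynomial.eval z) hdet
  rw [MvPolynomial.eval_map, RingHom.map_det] at this
  exact this

theorem eval_eq_det_pencil
    (hdet : MvPolynomial.map Complex.ofRealHom f = (detRepMatrix A₀ A).det)
    (x : Fin n ⊕ Fin k → ℝ) :
    ((MvPolynomial.eval x f : ℝ) : ℂ) = (pencil A₀ A (fun v => (x v : ℂ))).det := by
  rw [← aeval_eq_det_pencil hdet]
  exact (MvPolynomial.aeval_algebraMap_apply ℂ x f).symm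

theorem ofReal_add_single {σ : Type*} [DecidableEq σ] (x : σ → ℝ) (v : σ) (s : ℝ) :
    (fun u => ((x + Pi.single v s : σ → ℝ) u : ℂ)) = (fun u => (x u : ℂ)) + Pi.single v (s : ℂ) := by
  ext u
  by_cases hu : u = v
  · subst hu; simp
  · simp [hu]

theorem eval_add_single
    (hdet : MvPolynomial.map Complex.ofRealHom f = (detRepMatrix A₀ A).det)
    (x : Fin n ⊕ Fin k → ℝ) (i : Fin n) (s : ℝ) :
    MvPolynomial.eval (x + Pi.single (Sum.inl i) s) f = MvPolynomial.eval x f +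
      s * (MvPolynomial.eval (x + Pi.single (Sum.inl i) 1) f - MvPolynomial.eval x f) := by
  apply Complex.ofReal_injective
  push_cast
  simp only [eval_eq_det_pencil hdet, ofReal_add_single, pencil_add_single_inl, Complex.ofReal_one]
  exact Matrix.det_add_single _ _ _

theorem eval_ne_zero_iff_det
    (hdet : MvPolynomial.map Complex.ofRealHom f = (detRepMatrix A₀ A).det)
    {x : Fin n ⊕ Fin k → ℝ} :
    MvPolynomial.eval x f ≠ 0 ↔ (pencil A₀ A (fun v => (x v : ℂ))).det ≠ 0 := by
  rw [← eval_eq_det_pencil hdet, Ne, Ne, Complex.ofReal_eq_zero]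

/-- The Rayleigh difference in terms of the inverse of the pencil. -/
theorem rayleigh_eq
    (hdet : MvPolynomial.map Complex.ofRealHom f = (detRepMatrix A₀ A).det)
    {x : Fin n ⊕ Fin k → ℝ} (hx : MvPolynomial.eval x f ≠ 0) (i j : Fin n) :
    ((MvPolynomial.eval (x + Pi.single (Sum.inl i) 1) f
      * MvPolynomial.eval (x + Pi.single (Sum.inl j) 1) f - MvPolynomial.eval x f
      * MvPolynomial.eval (x + Pi.single (Sum.inl i) 1 + Pi.single (Sum.inl j) 1) f : ℝ) : ℂ) =
    (MvPolynomial.eval x f : ℂ) ^ 2 * ((pencil A₀ A (fun v => (x v : ℂ)))⁻¹ i j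
      * (pencil A₀ A (fun v => (x v : ℂ)))⁻¹ j i) := by
  have hx' := (eval_ne_zero_iff_det hdet).1 hx
  push_cast
  simp only [eval_eq_det_pencil hdet, ofReal_add_single, pencil_add_single_inl, Complex.ofReal_one]
  rw [Matrix.det_add_single_add_single hx', Matrix.det_add_single_of_det_ne_zero hx',
    Matrix.det_add_single_of_det_ne_zero hx']
  ring

/-- The entry equals `f(x+eᵢ)/f(x) - 1`, a real number. -/
theorem conj_inv_pencil_diag
    (hdet : MvPolynomial.map Complex.ofRealHom f = (detRepMatrix A₀ A).det)
    {x : Fin n ⊕ Fin k → ℝ} (hx : MvPolynomial.eval x f ≠ 0) (i : Fin n) :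
    conj ((pencil A₀ A (fun v => (x v : ℂ)))⁻¹ i i) =
      (pencil A₀ A (fun v => (x v : ℂ)))⁻¹ i i := by
  have hx' := (eval_ne_zero_iff_det hdet).1 hx
  have h := eval_eq_det_pencil hdet (x + Pi.single (Sum.inl i) 1)
  rw [ofReal_add_single, pencil_add_single_inl, Complex.ofReal_one,
    Matrix.det_add_single_of_det_ne_zero hx', ← eval_eq_det_pencil hdet] at h
  have h1 : (MvPolynomial.eval x f : ℂ) ≠ 0 := by exact_mod_cast hx
  have h2 : (pencil A₀ A (fun v => (x v : ℂ)))⁻¹ i i =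
      ((MvPolynomial.eval (x + Pi.single (Sum.inl i) 1) f / MvPolynomial.eval x f - 1 : ℝ) : ℂ) := by
    push_cast
    rw [h]
    field_simp
    ring
  rw [h2, Complex.conj_ofReal]

/-- Stability makes the Rayleigh difference nonnegative. -/
theorem IsRealStable.inv_pencil_mul_nonneg (hstable : IsRealStable f)
    (hdet : MvPolynomial.map Complex.ofRealHom f = (detRepMatrix A₀ A).det)
    {x : Fin n ⊕ Fin k → ℝ} (hx : MvPolynomial.eval x f ≠ 0) (i j : Fin n) :
    0 ≤ (pencil A₀ A (fun v => (x v : ℂ)))⁻¹ i j * (pencil A₀ A (fun v => (x v : ℂ)))⁻¹ j i := by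
  have hx' := (eval_ne_zero_iff_det hdet).1 hx
  set N := (pencil A₀ A (fun v => (x v : ℂ)))⁻¹ with hN
  obtain ⟨r, hr⟩ : ∃ r : ℝ, N i j * N j i = r := by
    obtain ⟨Δ, h⟩ : ∃ Δ : ℝ, (Δ : ℂ) = (MvPolynomial.eval x f : ℂ) ^ 2 * (N i j * N j i) :=
      ⟨_, rayleigh_eq hdet hx i j⟩
    have h1 : (MvPolynomial.eval x f : ℂ) ≠ 0 := by exact_mod_cast hx
    refine ⟨Δ / MvPolynomial.eval x f ^ 2, ?_⟩
    rw [Complex.ofReal_div, h, Complex.ofReal_pow]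
    field_simp
  rw [hr]
  by_contra hneg
  have hr0 : r < 0 := by
    by_contra h
    exact hneg (by exact_mod_cast not_lt.1 h)
  obtain ⟨a, ha⟩ := Complex.conj_eq_iff_real.1 (conj_inv_pencil_diag hdet hx i)
  obtain ⟨b, hb⟩ := Complex.conj_eq_iff_real.1 (conj_inv_pencil_diag hdet hx j)
  -- Coordinate `i` is raised by `I`, the others by `ε I`. As a function of a shift of coordinate
  -- `j`, the determinant is affine with root `φ ε = -d ε / c ε`. At `ε = 0` this root has imaginary
  -- part a positive multiple of `-r`. By continuity it stays in the upper half-plane for small `ε >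
  -- 0`, giving a zero forbidden by stability.
  let u : ℝ → Fin n ⊕ Fin k → ℂ := fun ε v =>
    x v + (if v = Sum.inl i then Complex.I else ε * Complex.I)
  have hu : Continuous u := by
    refine continuous_pi fun v => ?_
    by_cases hv : v = Sum.inl i
    · simp only [u, hv, if_true]; fun_prop
    · simp only [u, hv, if_false]; fun_prop
  let d : ℝ → ℂ := fun ε => (pencil A₀ A (u ε)).det
  let c : ℝ → ℂ := fun ε => (pencil A₀ A (u ε) + Matrix.single j j 1).det - d ε
  have hpc : Continuous fun ε => pencil A₀ A (u ε) := (continuous_pencil A₀ A).comp hu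
  have hd : Continuous d := hpc.matrix_det
  have hc : Continuous c := ((hpc.add continuous_const).matrix_det).sub hd
  have hu0 : u 0 = (fun v => (x v : ℂ)) + Pi.single (Sum.inl i) Complex.I := by
    ext v
    by_cases hv : v = Sum.inl i
    · subst hv; simp [u]
    · simp [u, hv]
  set δ := (pencil A₀ A (fun v => (x v : ℂ))).det with hδ
  have hd0 : d 0 = δ * (1 + Complex.I * a) := by
    simp only [d, hu0, pencil_add_single_inl]
    rw [Matrix.det_add_single_of_det_ne_zero hx', ha]
  have hc0 : c 0 = δ * (b + Complex.I * (a * b - r)) := by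
    simp only [c, hd0, hu0, pencil_add_single_inl]
    rw [Matrix.det_add_single_add_single hx', ha, hb, ← hN, hr]
    ring
  have hw : (b + Complex.I * (a * b - r) : ℂ) ≠ 0 := by
    intro h
    have h1 := congrArg Complex.re h
    have h2 := congrArg Complex.im h
    simp at h1 h2
    rw [h1] at h2
    linarith
  have hc0' : c 0 ≠ 0 := by rw [hc0]; exact mul_ne_zero hx' hw
  let φ : ℝ → ℂ := fun ε => -(d ε) / c ε
  have hφ : ContinuousAt φ 0 := hd.continuousAt.neg.div hc.continuousAt hc0'
  have hφ0 : 0 < (φ 0).im := by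
    have h1 : φ 0 = -(1 + Complex.I * a) / (b + Complex.I * (a * b - r)) := by
      simp only [φ, hd0, hc0]
      rw [neg_mul_eq_mul_neg, mul_div_mul_left _ _ hx']
    have h2 := Complex.normSq_pos.2 hw
    rw [h1, Complex.div_im, ← sub_div]
    apply div_pos _ h2
    simp
    linarith
  have hev : ∀ᶠ ε in nhds (0 : ℝ), 0 < (φ ε).im ∧ c ε ≠ 0 :=
    ((Complex.continuous_im.continuousAt.comp hφ).eventually (lt_mem_nhds hφ0)).and
      (hc.continuousAt.eventually_ne hc0')
  obtain ⟨ρ, hρ, hball⟩ := Metric.eventually_nhds_iff.1 hev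
  obtain ⟨h1, h2⟩ := hball (y := ρ / 2) (by rw [Real.dist_eq, sub_zero, abs_of_pos] <;> linarith)
  refine hstable (u (ρ / 2) + Pi.single (Sum.inl j) (φ (ρ / 2))) ?_ ?_
  · intro v
    have hv : 0 < (u (ρ / 2) v).im := by
      by_cases hv : v = Sum.inl i
      · simp [u, hv]
      · simp [u, hv, hρ]
    by_cases hj : v = Sum.inl j
    · subst hj
      simpa using add_pos hv h1
    · simpa [hj] using hv
  · rw [aeval_eq_det_pencil hdet, pencil_add_single_inl, Matrix.det_add_single]
    change d (ρ / 2) + -(d (ρ / 2)) / c (ρ / 2) * c (ρ / 2) = 0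
    rw [div_mul_cancel₀ _ h2, add_neg_cancel]

end Pencil

/-! ### Irreducibility, and one symmetrizer for all real points. -/

section Irreducible

variable {n k : ℕ} {A₀ : Matrix (Fin n) (Fin n) ℂ} {A : Fin k → Matrix (Fin n) (Fin n) ℂ}
  {f : MvPolynomial (Fin n ⊕ Fin k) ℝ}

/-- The polynomial `f` depends on each diagonal variable. -/
theorem exists_eval_add_single_ne
    (hdet : MvPolynomial.map Complex.ofRealHom f = (detRepMatrix A₀ A).det) (i : Fin n) :
    ∃ x : Fin n ⊕ Fin k → ℝ,
      MvPolynomial.eval (x + Pi.single (Sum.inl i) 1) f ≠ MvPolynomial.eval x f := by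
  by_contra! hcon
  -- These are rescaled values of `f` as all diagonal variables tend to infinity with `τ⁻¹`.
  -- Independence of `xᵢ` would give `g = h` for `τ ≠ 0`, hence at `τ = 0`, where the values are 1
  -- and 0.
  let g : ℝ → ℂ := fun τ => (1 + (τ : ℂ) • A₀).det
  let h : ℝ → ℂ := fun τ => (1 + (τ : ℂ) • A₀ + Matrix.single i i (-1)).det
  have hA : Continuous fun τ : ℝ => 1 + (τ : ℂ) • A₀ := by fun_prop
  have hgh : g = h := by
    refine Continuous.ext_on (dense_compl_singleton (0 : ℝ)) hA.matrix_det
      (hA.add continuous_const).matrix_det fun τ hτ => ?_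
    have hτ' : (τ : ℂ) ≠ 0 := by exact_mod_cast hτ
    let x : Fin n ⊕ Fin k → ℝ := Sum.elim (fun _ => τ⁻¹) 0
    have hx : pencil A₀ A (fun v => (x v : ℂ)) = (τ : ℂ)⁻¹ • (1 + (τ : ℂ) • A₀) := by
      rw [pencil_eq, smul_add, smul_smul, inv_mul_cancel₀ hτ', one_smul, Matrix.smul_one_eq_diagonal]
      simp [x]
    have h1 := eval_add_single hdet x i (-τ⁻¹)
    rw [hcon, sub_self, mul_zero, add_zero] at h1
    have h2 := congrArg Complex.ofReal h1
    have h3 : Matrix.single i i ((-τ⁻¹ : ℝ) : ℂ) = (τ : ℂ)⁻¹ • Matrix.single i i (-1) := by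
      rw [Matrix.smul_single]; simp
    rw [eval_eq_det_pencil hdet, eval_eq_det_pencil hdet, ofReal_add_single,
      pencil_add_single_inl, hx, h3, ← smul_add, Matrix.det_smul, Matrix.det_smul] at h2
    exact (mul_left_cancel₀ (pow_ne_zero _ (inv_ne_zero hτ')) h2).symm
  have h0 := congrFun hgh 0
  have h1 : (1 : Matrix (Fin n) (Fin n) ℂ).det ≠ 0 := by simp
  simp only [g, h, Complex.ofReal_zero, zero_smul, add_zero] at h0
  rw [Matrix.det_add_single_of_det_ne_zero h1] at h0
  simp at h0

theorem not_dvd_translate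
    (hdet : MvPolynomial.map Complex.ofRealHom f = (detRepMatrix A₀ A).det) (i : Fin n) :
    ¬ f ∣ MvPolynomial.translate (Pi.single (Sum.inl i) 1) f := by
  rintro ⟨g, hg⟩
  obtain ⟨x, hx⟩ := exists_eval_add_single_ne hdet i
  set δ := MvPolynomial.eval (x + Pi.single (Sum.inl i) 1) f - MvPolynomial.eval x f with hδ
  have hδ0 : δ ≠ 0 := sub_ne_zero.2 hx
  -- On the line through `x` along `eᵢ`, `f` is affine with slope `δ`: at this `s` it vanishes while
  -- its translate equals `δ ≠ 0`.
  set s := -MvPolynomial.eval x f / δ with hs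
  have hsδ : s * δ = -MvPolynomial.eval x f := div_mul_cancel₀ _ hδ0
  have h1 := congrArg (MvPolynomial.eval (x + Pi.single (Sum.inl i) s)) hg
  rw [MvPolynomial.eval_translate, map_mul, add_assoc, ← Pi.single_add,
    eval_add_single hdet, eval_add_single hdet x i s, ← hδ, add_mul, hsδ] at h1
  apply hδ0
  linear_combination h1

/-- The Rayleigh difference of `f` with respect to two diagonal variables. -/
noncomputable def rayleighDiff (f : MvPolynomial (Fin n ⊕ Fin k) ℝ) (i j : Fin n) :
    MvPolynomial (Fin n ⊕ Fin k) ℝ :=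
  MvPolynomial.translate (Pi.single (Sum.inl i) 1) f
    * MvPolynomial.translate (Pi.single (Sum.inl j) 1) f
  - f * MvPolynomial.translate (Pi.single (Sum.inl i) 1)
      (MvPolynomial.translate (Pi.single (Sum.inl j) 1) f)

/-- If it vanished, `f` would divide a product of two of its translates and, being prime, one of
them. -/
theorem rayleighDiff_ne_zero (hirr : Irreducible f)
    (hdet : MvPolynomial.map Complex.ofRealHom f = (detRepMatrix A₀ A).det) (i j : Fin n) :
    rayleighDiff f i j ≠ 0 := by
  intro h
  rcases hirr.prime.dvd_or_dvd (Dvd.intro _ (sub_eq_zero.1 h).symm) with h | h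
  · exact not_dvd_translate hdet i h
  · exact not_dvd_translate hdet j h

theorem eval_rayleighDiff
    (hdet : MvPolynomial.map Complex.ofRealHom f = (detRepMatrix A₀ A).det)
    {x : Fin n ⊕ Fin k → ℝ} (hx : MvPolynomial.eval x f ≠ 0) (i j : Fin n) :
    ((MvPolynomial.eval x (rayleighDiff f i j) : ℝ) : ℂ) =
    (MvPolynomial.eval x f : ℂ) ^ 2 * ((pencil A₀ A (fun v => (x v : ℂ)))⁻¹ i j
      * (pencil A₀ A (fun v => (x v : ℂ)))⁻¹ j i) := by
  rw [← rayleigh_eq hdet hx]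
  simp only [rayleighDiff, map_sub, map_mul, MvPolynomial.eval_translate]

theorem pencil_symm_of_rayleighDiff_ne_zero (hstable : IsRealStable f)
    (hdet : MvPolynomial.map Complex.ofRealHom f = (detRepMatrix A₀ A).det)
    {x : Fin n ⊕ Fin k → ℝ} (hx : MvPolynomial.eval x f ≠ 0)
    (hΔ : ∀ i j, MvPolynomial.eval x (rayleighDiff f i j) ≠ 0) :
    ∃ e : Fin n → ℝ, (∀ i, 0 < e i) ∧ ∀ i j,
      pencil A₀ A (fun v => (x v : ℂ)) j i =
        e j / e i * conj (pencil A₀ A (fun v => (x v : ℂ)) i j) := by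
  refine Matrix.exists_pos_div_mul_conj ((eval_ne_zero_iff_det hdet).1 hx)
    (conj_inv_pencil_diag hdet hx) (fun i j _ h0 => hΔ i j ?_) (fun i j a t _ ht => ?_)
  · have := eval_rayleighDiff hdet hx i j
    rw [h0, zero_mul, mul_zero] at this
    exact_mod_cast this
  · rw [← pencil_add_single_inl, ← ofReal_add_single] at ht ⊢
    exact hstable.inv_pencil_mul_nonneg hdet ((eval_ne_zero_iff_det hdet).2 ht) i j

/-- One positive diagonal matrix symmetrizes the values of the pencil at all real points. -/
theorem exists_pencil_symm (hstable : IsRealStable f) (hirr : Irreducible f)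
    (hdet : MvPolynomial.map Complex.ofRealHom f = (detRepMatrix A₀ A).det) :
    ∃ e : Fin n → ℝ, (∀ i, 0 < e i) ∧ ∀ (x : Fin n ⊕ Fin k → ℝ) i j,
      pencil A₀ A (fun v => (x v : ℂ)) j i =
        e j / e i * conj (pencil A₀ A (fun v => (x v : ℂ)) i j) := by
  classical
  -- Identically zero entries are replaced by 1, so that `H` is nonzero and `H ≠ 0` at a point keeps
  -- every other entry nonzero there.
  let P : Fin n → Fin n → MvPolynomial (Fin n ⊕ Fin k) ℂ := fun i j =>
    if detRepMatrix A₀ A i j = 0 then 1 else detRepMatrix A₀ A i j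
  let H : MvPolynomial (Fin n ⊕ Fin k) ℂ := MvPolynomial.map Complex.ofRealHom
    (f * ∏ i, ∏ j, rayleighDiff f i j) * ∏ i, ∏ j, P i j
  have hH : H ≠ 0 := by
    refine mul_ne_zero ?_ (Finset.prod_ne_zero_iff.2 fun i _ => Finset.prod_ne_zero_iff.2 fun j _ => ?_)
    · rw [Ne, map_eq_zero_iff _ (MvPolynomial.map_injective _ Complex.ofReal_injective)]
      exact mul_ne_zero hirr.ne_zero (Finset.prod_ne_zero_iff.2 fun i _ =>
        Finset.prod_ne_zero_iff.2 fun j _ => rayleighDiff_ne_zero hirr hdet i j)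
    · by_cases h : detRepMatrix A₀ A i j = 0 <;> simp [P, h]
  have hdense := MvPolynomial.dense_eval_ofReal_ne_zero hH
  set S := {x : Fin n ⊕ Fin k → ℝ | MvPolynomial.eval (fun v => (x v : ℂ)) H ≠ 0}
  have hmap : ∀ (x : Fin n ⊕ Fin k → ℝ) (p : MvPolynomial (Fin n ⊕ Fin k) ℝ),
      MvPolynomial.eval (fun v => (x v : ℂ)) (MvPolynomial.map Complex.ofRealHom p) =
        (MvPolynomial.eval x p : ℂ) := fun x p => by
    rw [MvPolynomial.eval_map]
    exact MvPolynomial.aeval_algebraMap_apply ℂ x p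
  have hS : ∀ x ∈ S, MvPolynomial.eval x f ≠ 0 ∧
      (∀ i j, MvPolynomial.eval x (rayleighDiff f i j) ≠ 0) ∧
      ∀ i j, MvPolynomial.eval (fun v => (x v : ℂ)) (P i j) ≠ 0 := by
    intro x hx
    simp only [S, H, Set.mem_ofPred_eq, map_mul, map_prod, hmap, mul_ne_zero_iff,
      Finset.prod_ne_zero_iff, Finset.mem_univ, true_imp_iff, Complex.ofReal_ne_zero] at hx
    exact ⟨hx.1.1, hx.1.2, hx.2⟩
  have hsymm : ∀ x ∈ S, _ := fun x hx =>
    pencil_symm_of_rayleighDiff_ne_zero hstable hdet (hS x hx).1 (hS x hx).2.1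
  -- The symmetrizer found at a generic point may depend on the point, but the sign of this product
  -- does not, so it passes to the closure.
  have hnonneg : ∀ (x : Fin n ⊕ Fin k → ℝ) i j,
      0 ≤ pencil A₀ A (fun v => (x v : ℂ)) i j * pencil A₀ A (fun v => (x v : ℂ)) j i := by
    intro x i j
    have hcont : ∀ a b, Continuous fun x : Fin n ⊕ Fin k → ℝ =>
        pencil A₀ A (fun v => (x v : ℂ)) a b := fun a b =>
      ((continuous_pencil A₀ A).comp (by fun_prop)).matrix_elem a b
    refine (isClosed_le continuous_const ((hcont i j).mul (hcont j i))).closure_subset_iff.2 ?_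
      (hdense x)
    intro y hy
    obtain ⟨e, he, hey⟩ := hsymm y hy
    change 0 ≤ pencil A₀ A (fun v => (y v : ℂ)) i j * pencil A₀ A (fun v => (y v : ℂ)) j i
    rw [hey i j, mul_left_comm, Complex.mul_conj, ← Complex.ofReal_div,
      ← Complex.ofReal_mul]
    exact_mod_cast mul_nonneg (div_pos (he j) (he i)).le (Complex.normSq_nonneg _)
  obtain ⟨z, hz⟩ := hdense.nonempty
  obtain ⟨e, he, hez⟩ := hsymm z hz
  refine ⟨e, he, fun x i j => ?_⟩
  have hec : ∀ i, (e i : ℂ) ≠ 0 := fun i => by exact_mod_cast (he i).ne'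
  have hswap : ∀ {i j}, detRepMatrix A₀ A i j = 0 → detRepMatrix A₀ A j i = 0 := by
    intro i j h
    by_contra hji
    have h1 := (hS z hz).2.2 j i
    simp only [P, hji, if_false] at h1
    apply h1
    have h2 := hez i j
    rw [pencil_apply, pencil_apply, h] at h2
    simpa using h2
  by_cases hij : detRepMatrix A₀ A i j = 0
  · rw [pencil_apply, pencil_apply, hij, hswap hij]
    simp
  have hji : detRepMatrix A₀ A j i ≠ 0 := fun h => hij (hswap h)
  have h1 := (hS z hz).2.2 i j
  have h2 := (hS z hz).2.2 j i
  simp only [P, hij, hji, if_false, ← pencil_apply] at h1 h2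
  have hline : ∀ t : ℝ, ∀ a b, pencil A₀ A (fun v => ((z v + t * (x v - z v) : ℝ) : ℂ)) a b =
      pencil A₀ A (fun v => (z v : ℂ)) a b + t * (pencil A₀ A (fun v => (x v : ℂ)) a b
        - pencil A₀ A (fun v => (z v : ℂ)) a b) := by
    intro t a b
    have := congrFun (congrFun (pencil_affine A₀ A (fun v => (z v : ℂ)) (fun v => (x v : ℂ)) t) a) b
    push_cast
    simpa using this
  -- On the line from `z` to `x` the two entries are affine with nonnegative product, so their ratio
  -- up to conjugation is the one at `z`.
  have hQ := Complex.mul_conj_eq_of_affine_mul_nonneg dense_univ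
    (fun t _ => by
      have := hnonneg (fun v => z v + t * (x v - z v)) i j
      rwa [hline, hline] at this) h1 h2
  have h3 : conj (pencil A₀ A (fun v => (z v : ℂ)) i j) ≠ 0 := by simpa using h1
  apply mul_right_cancel₀ h3
  rw [map_sub] at hQ
  rw [hez i j] at hQ
  linear_combination hQ

end Irreducible

/-! ### Hermitian coefficient matrices. -/

theorem isHermitian_realConj_diagonal {n : ℕ} {e : Fin n → ℝ} (he : ∀ i, 0 < e i)
    {B : Matrix (Fin n) (Fin n) ℂ} (hB : ∀ i j, B j i = e j / e i * conj (B i j)) :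
    (realConj (Matrix.diagonal fun i => Real.sqrt (e i)) B).IsHermitian := by
  have hpos : ∀ i, ((Real.sqrt (e i) : ℝ) : ℂ) ≠ 0 := fun i => by
    exact_mod_cast (Real.sqrt_pos.2 (he i)).ne'
  have hinv : ((Matrix.diagonal fun i => Real.sqrt (e i)).map Complex.ofReal)⁻¹
      = Matrix.diagonal fun i => ((Real.sqrt (e i) : ℝ) : ℂ)⁻¹ := by
    apply Matrix.inv_eq_right_inv
    rw [Matrix.diagonal_map Complex.ofReal_zero, Matrix.diagonal_mul_diagonal]
    simp only [mul_inv_cancel₀ (hpos _), Matrix.diagonal_one]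
  ext i j
  rw [realConj, hinv, Matrix.diagonal_map Complex.ofReal_zero, Matrix.conjTranspose_apply]
  simp only [Matrix.mul_diagonal, Matrix.diagonal_mul, Complex.star_def, map_mul, map_inv₀,
    Complex.conj_ofReal]
  have hsq : ∀ i, (e i : ℂ) = (Real.sqrt (e i) : ℂ) ^ 2 := fun i => by
    exact_mod_cast (Real.sq_sqrt (he i).le).symm
  have h1 := hpos i
  have h2 := hpos j
  rw [hB j i, hsq i, hsq j]
  field_simp

theorem theorem6p6 (n k : ℕ) (f : MvPolynomial (Fin n ⊕ Fin k) ℝ)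
    (hstable : IsRealStable f) (hirr : Irreducible f)
    (A₀ : Matrix (Fin n) (Fin n) ℂ) (A : Fin k → Matrix (Fin n) (Fin n) ℂ)
    (hdet : MvPolynomial.map Complex.ofRealHom f = (detRepMatrix A₀ A).det) :
    ∃ D : Matrix (Fin n) (Fin n) ℝ, D.IsDiag ∧ IsUnit D ∧
      (realConj D A₀).IsHermitian ∧ ∀ j, (realConj D (A j)).IsHermitian := by
  obtain ⟨e, he, hsymm⟩ := exists_pencil_symm hstable hirr hdet
  have hA₀ : ∀ i j, A₀ j i = e j / e i * conj (A₀ i j) := by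
    intro i j
    simpa [pencil_eq] using hsymm 0 i j
  refine ⟨Matrix.diagonal fun i => Real.sqrt (e i), Matrix.isDiag_diagonal _, ?_,
    isHermitian_realConj_diagonal he hA₀, fun l => isHermitian_realConj_diagonal he fun i j => ?_⟩
  · rw [Matrix.isUnit_diagonal, Pi.isUnit_iff]
    exact fun i => (Real.sqrt_pos.2 (he i)).ne'.isUnit
  -- The symmetry relation is additive, so subtracting its instance for `A₀` isolates `A l`.
  · have h : ∀ a b, pencil A₀ A (fun v => ((Pi.single (Sum.inr l) 1 : Fin n ⊕ Fin k → ℝ) v : ℂ)) a b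
        = A l a b + A₀ a b := by
      intro a b
      simp [pencil_eq, Pi.single_apply]
    have := hsymm (Pi.single (Sum.inr l) 1) i j
    rw [h, h, map_add, hA₀ i j] at this
    linear_combination this
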